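/- Let $n\ge 2$, $2\le r\le\infty$, and let $(M,g)$ be an $n$-dimensional spacetime, i.e. a connected, Hausdorff, second countable $C^{r+1}$ manifold $M$ with a time-oriented Lorentzian metric $g$ of class $C^r$ and signature $(-,+,\dots,+)$. For such metrics on $M$ write $g'>g$ if every future directed causal vector of $g$ (causal: nonzero, and timelike or lightlike) is future directed timelike for $g'$. Given a property $\mathcal P$ of spacetimes, $(M,g)$ is called stably $\mathcal P$ if there is $g'>g$ such that $(M,g')$ has the property $\mathcal P$. In particular $(M,g)$ is stably causal if there is $g'>g$ such that $(M,g')$ is causal. Let $I^+$ be the set of pairs $(x,z)\in M\times M$ such that there is a future directed timelike piecewise $C^1$ curve from $x$ to $z$, let $J^+$ be the set of pairs such that $x=z$ or there is a future directed causal piecewise $C^1$ curve from $x$ to $z$, and let $K^+$ be the smallest closed and transitive relation on $M$ which contains $I^+$. The spacetime is - chronological if it has no closed timelike curve; causal if it has no closed causal curve; - distinguishing if $I^+(x)=I^+(y)$ implies $x=y$ and $I^-(x)=I^-(y)$ implies $x=y$; - strongly causal if for every $x\in M$ every neighborhood $U$ of $x$ contains a neighborhood $V$ of $x$ such that every causal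 curve with endpoints in $V$ is contained in $U$; - $K$-causal if $K^+$ is a partial order. Then the following properties of $(M,g)$ are each equivalent to stable causality: stable chronology, stable distinction, stable strong causality, stable $K$-causality, and stable stable causality (there is $g'>g$ such that $(M,g')$ is stably causal). -/

import Mathlib

open Set Bundle
open scoped Manifold ContDiff Topology

noncomputable section

namespace Spacetimes

section Defs

variable {n : ℕ} {r : ℕ∞} {M : Type*} [TopologicalSpace M]
  [ChartedSpace (EuclideanSpace ℝ (Fin n)) M] [IsManifold (𝓡 n) 1 M]

variable (n r M) in
/-- A Lorentzian metric of class `C^r` on the `n`-dimensional manifold `M`, of signature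
`(-, +, …, +)`: a `C^r` section of the bundle of bilinear forms on the tangent spaces which at
each point is symmetric, negative on some vector `u`, and positive definite on the orthogonal
complement of `u`. -/
structure LorentzMetric where
  /-- The bilinear form on the tangent space at `x`. -/
  val (x : M) : TangentSpace (𝓡 n) x →L[ℝ] TangentSpace (𝓡 n) x →L[ℝ] ℝ
  symm (x : M) (v w : TangentSpace (𝓡 n) x) : val x v w = val x w v
  signature (x : M) : ∃ u : TangentSpace (𝓡 n) x, val x u u < 0 ∧
    ∀ w : TangentSpace (𝓡 n) x, w ≠ 0 → val x u w = 0 → 0 < val x w w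
  contMDiff : ContMDiff (𝓡 n)
    ((𝓡 n).prod 𝓘(ℝ, EuclideanSpace ℝ (Fin n) →L[ℝ] EuclideanSpace ℝ (Fin n) →L[ℝ] ℝ)) r
    (fun x : M ↦ TotalSpace.mk'
      (EuclideanSpace ℝ (Fin n) →L[ℝ] EuclideanSpace ℝ (Fin n) →L[ℝ] ℝ) x (val x))

variable (n r M) in
/-- A time-oriented Lorentzian metric of class `C^r` on `M`; the time orientation is given by a
continuous timelike vector field. -/
structure SpacetimeMetric extends LorentzMetric n r M where
  /-- The vector field that gives the time orientation. -/
  orient (x : M) : TangentSpace (𝓡 n) x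
  orient_timelike (x : M) : val x (orient x) (orient x) < 0
  orient_continuous :
    Continuous (fun x : M ↦ (TotalSpace.mk' (EuclideanSpace ℝ (Fin n)) x (orient x) :
      TangentBundle (𝓡 n) M))

/-- The tangent vector `v` at `x` is timelike and future directed. -/
def FutureTimelike (g : SpacetimeMetric n r M) (x : M) (v : TangentSpace (𝓡 n) x) : Prop :=
  g.val x v v < 0 ∧ g.val x (g.orient x) v < 0

/-- The tangent vector `v` at `x` is causal (nonzero, and timelike or lightlike) and
future directed. -/
def FutureCausal (g : SpacetimeMetric n r M) (x : M) (v : TangentSpace (𝓡 n) x) : Prop :=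
  v ≠ 0 ∧ g.val x v v ≤ 0 ∧ g.val x (g.orient x) v < 0

/-- `g < g'`: every causal vector for `g` is timelike for `g'`, the time orientations being the
corresponding ones. The statement for past directed vectors follows by changing sign. -/
def Narrower (g g' : SpacetimeMetric n r M) : Prop :=
  ∀ (x : M) (v : TangentSpace (𝓡 n) x), FutureCausal g x v → FutureTimelike g' x v

/-- `γ`, restricted to `[a, b]`, is a `C^1` curve whose velocity is everywhere future directed
timelike (one-sided derivatives are used at the endpoints). -/
def IsTimelikeCurveOn (g : SpacetimeMetric n r M) (γ : ℝ → M) (a b : ℝ) : Prop :=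
  ContMDiffOn 𝓘(ℝ, ℝ) (𝓡 n) 1 γ (Icc a b) ∧
    ∀ t ∈ Icc a b,
      FutureTimelike g (γ t) (mfderivWithin 𝓘(ℝ, ℝ) (𝓡 n) γ (Icc a b) t (1 : ℝ))

/-- `γ`, restricted to `[a, b]`, is a `C^1` curve whose velocity is everywhere future directed
causal (one-sided derivatives are used at the endpoints). -/
def IsCausalCurveOn (g : SpacetimeMetric n r M) (γ : ℝ → M) (a b : ℝ) : Prop :=
  ContMDiffOn 𝓘(ℝ, ℝ) (𝓡 n) 1 γ (Icc a b) ∧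
    ∀ t ∈ Icc a b,
      FutureCausal g (γ t) (mfderivWithin 𝓘(ℝ, ℝ) (𝓡 n) γ (Icc a b) t (1 : ℝ))

/-- There is a future directed timelike `C^1` curve from `x` to `z`. -/
def TimelikeSegment (g : SpacetimeMetric n r M) (x z : M) : Prop :=
  ∃ (γ : ℝ → M) (a b : ℝ), a < b ∧ γ a = x ∧ γ b = z ∧ IsTimelikeCurveOn g γ a b

/-- There is a future directed causal `C^1` curve from `x` to `z`. -/
def CausalSegment (g : SpacetimeMetric n r M) (x z : M) : Prop :=
  ∃ (γ : ℝ → M) (a b : ℝ), a < b ∧ γ a = x ∧ γ b = z ∧ IsCausalCurveOn g γ a b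

/-- The chronological relation `I⁺`: there is a future directed timelike piecewise `C^1` curve
(a finite, nonempty concatenation of `C^1` ones) from `x` to `z`. -/
def I (g : SpacetimeMetric n r M) : M → M → Prop :=
  Relation.TransGen (TimelikeSegment g)

/-- There is a future directed causal piecewise `C^1` curve (a finite, nonempty concatenation of
`C^1` ones) from `x` to `z`. -/
def CausalCurveJoins (g : SpacetimeMetric n r M) : M → M → Prop :=
  Relation.TransGen (CausalSegment g)

/-- The causal relation `J⁺`: `x = z`, or there is a future directed causal curve from `x`
to `z`. -/
def J (g : SpacetimeMetric n r M) (x z : M) : Prop :=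
  x = z ∨ CausalCurveJoins g x z

/-- The relation `K⁺`: the smallest closed and transitive relation that contains `I⁺`, that is,
the intersection of all of them. -/
def K (g : SpacetimeMetric n r M) (x z : M) : Prop :=
  ∀ R : M → M → Prop, IsClosed {p : M × M | R p.1 p.2} →
    (∀ a b c, R a b → R b c → R a c) → (∀ a b, I g a b → R a b) → R x z

/-- Chronology: there are no closed timelike curves. -/
def IsChronological (g : SpacetimeMetric n r M) : Prop :=
  ∀ x, ¬ I g x x

/-- Causality: there are no closed causal curves. -/
def IsCausal (g : SpacetimeMetric n r M) : Prop :=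
  ∀ x, ¬ CausalCurveJoins g x x

/-- Distinction: distinct points have distinct chronological futures and distinct chronological
pasts. -/
def IsDistinguishing (g : SpacetimeMetric n r M) : Prop :=
  (∀ x y, {z | I g x z} = {z | I g y z} → x = y) ∧
    (∀ x y, {z | I g z x} = {z | I g z y} → x = y)

/-- Strong causality: every neighborhood `U` of a point `x` contains a neighborhood `V` of `x`
such that every causal curve with endpoints in `V` is contained in `U`. -/
def IsStronglyCausal (g : SpacetimeMetric n r M) : Prop :=
  ∀ x, ∀ U ∈ 𝓝 x, ∃ V ∈ 𝓝 x, V ⊆ U ∧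
    ∀ y ∈ V, ∀ w ∈ V, ∀ z, J g y z → J g z w → z ∈ U

/-- `K`-causality: `K⁺` is a partial order. -/
def IsKCausal (g : SpacetimeMetric n r M) : Prop :=
  IsPartialOrder M (K g)

/-- The property stable-`P`: the property `P` holds for some `g' > g`. -/
def Stably (P : SpacetimeMetric n r M → Prop) (g : SpacetimeMetric n r M) : Prop :=
  ∃ g' : SpacetimeMetric n r M, Narrower g g' ∧ P g'

/-- Stable causality: there is `g' > g` such that `(M, g')` is causal. -/
def IsStablyCausal (g : SpacetimeMetric n r M) : Prop :=
  Stably IsCausal g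

end Defs

end Spacetimes

end

/-!
The five equivalences rest on two ways of comparing metrics `g < g'`.

If `g < g'`, then a `g`-causal curve is `g'`-timelike, and there is a metric strictly between the
two, namely `g + g'` (`sumMetric`): a vector at which `g + g'` is nonpositive is `g'`-timelike, and
a `g`-causal vector is timelike for `g + g'`; the sum is Lorentzian since it is negative on one
vector and positive definite on a hyperplane (`pos_of_orthogonal_of_pos_on_ker`). Therefore a metric
below a chronological one is causal. Distinction, strong causality and `K`-causality each exclude
closed timelike curves, because such a curve passes through two distinct points in the chronological
future of each other (`exists_ne_of_I_self`). Hence the stable form of each of them implies stable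
causality.

Conversely, every metric `g` below a causal metric `g'` has all these properties. The reason is that
widening the cones absorbs small displacements of an endpoint: if `p` is close to `x`, then any
`g`-causal curve from `p` to a point `q` not close to `x` can be replaced by a `g'`-timelike curve
from `x` to `q` (`Narrower.exists_nhds_I_of_causalCurveJoins`). To see this, follow the curve to its
exit point `z` from a small coordinate ball about `x`. In the ball the `g`-causal vectors lie in one
closed convex cone, of an intermediate metric at `x`, so `z - p` lies in this cone, and `z - x`
is so close to it in direction that the straight line from `x` to `z` is `g'`-timelike. No limit
curve theorem is needed. A failure of strong causality or of distinction for `g` then produces a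
closed timelike curve for `g'`. For `K`-causality the same lemma shows that the Seifert relation, the
intersection of the causal relations of all metrics above `g`, is closed (`isClosed_seifert`); it is
transitive and contains the chronological relation, so it contains `K`, and it is antisymmetric
because `g'` is causal.
-/

namespace Spacetimes

/-! ### Lorentzian forms on a vector space -/

section LinearAlgebra

variable {V : Type*} [AddCommGroup V] [Module ℝ V] [TopologicalSpace V]
  {B : V →L[ℝ] V →L[ℝ] ℝ}

/-- A symmetric form that is negative on `T` and positive definite on the hyperplane `ker φ` is
positive definite on the orthogonal complement of `T`: otherwise `T` and a vector orthogonal to it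
would span a plane on which the form is nonpositive, and that plane meets `ker φ`. -/
theorem pos_of_orthogonal_of_pos_on_ker (hB : ∀ v w, B v w = B w v) (φ : V →L[ℝ] ℝ)
    (hφ : ∀ w, w ≠ 0 → φ w = 0 → 0 < B w w) {T : V} (hT : B T T < 0) {w : V} (hw : w ≠ 0)
    (hTw : B T w = 0) : 0 < B w w := by
  by_contra! h
  have hv : φ (φ w • T - φ T • w) = 0 := by simp [mul_comm]
  have hwT : B w T = 0 := by rw [hB, hTw]
  have hvv : B (φ w • T - φ T • w) (φ w • T - φ T • w) = φ w ^ 2 * B T T + φ T ^ 2 * B w w := by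
    simp [hTw, hwT]
    ring
  by_cases h0 : φ w • T - φ T • w = 0
  · have h1 : B T (φ w • T - φ T • w) = 0 := by rw [h0, map_zero]
    have h2 : φ w = 0 := by
      simpa [hTw, hT.ne] using h1
    have h3 : φ T = 0 := by
      simpa [h2, hw] using h0
    have hT0 : T ≠ 0 := by
      rintro rfl
      simp at hT
    exact absurd (hφ T hT0 h3) hT.not_gt
  · have h1 := hφ _ h0 hv
    rw [hvv] at h1
    nlinarith [mul_nonneg (sq_nonneg (φ w)) (neg_nonneg.2 hT.le),
      mul_nonneg (sq_nonneg (φ T)) (neg_nonneg.2 h)]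

/-- A symmetric bilinear form of signature `(-, +, …, +)`. -/
structure IsLorentzian (B : V →L[ℝ] V →L[ℝ] ℝ) : Prop where
  symm (v w : V) : B v w = B w v
  signature : ∃ u : V, B u u < 0 ∧ ∀ w : V, w ≠ 0 → B u w = 0 → 0 < B w w

namespace IsLorentzian

theorem pos_of_orthogonal (hB : IsLorentzian B) {T w : V} (hT : B T T < 0) (hw : w ≠ 0)
    (hTw : B T w = 0) : 0 < B w w := by
  obtain ⟨u, -, h⟩ := hB.signature
  exact pos_of_orthogonal_of_pos_on_ker hB.symm (B u) h hT hw hTw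

theorem apply_ne_zero (hB : IsLorentzian B) {T v : V} (hT : B T T < 0) (hv0 : v ≠ 0)
    (hv : B v v ≤ 0) : B T v ≠ 0 :=
  fun h ↦ (hB.pos_of_orthogonal hT hv0 h).not_ge hv

/-- The reverse Cauchy-Schwarz inequality in qualitative form: a timelike and a causal vector in
the same half of the cone have negative product. -/
theorem apply_neg (hB : IsLorentzian B) {T v w : V} (hT : B T T < 0) (hv : B v v < 0)
    (hTv : B T v < 0) (hw : B w w ≤ 0) (hTw : B T w < 0) : B v w < 0 := by
  by_contra! h
  have hu : B T (B T w • v - B T v • w) = 0 := by simp [mul_comm]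
  have hpos : 0 < B T w * B T v := mul_pos_of_neg_of_neg hTw hTv
  by_cases h0 : B T w • v - B T v • w = 0
  · have h1 : B v (B T w • v - B T v • w) = 0 := by rw [h0, map_zero]
    simp only [map_sub, map_smul, smul_eq_mul] at h1
    nlinarith [mul_pos_of_neg_of_neg hTw hv]
  · have h1 := hB.pos_of_orthogonal hT h0 hu
    simp only [map_sub, map_smul, smul_eq_mul, sub_apply,
      smul_apply, hB.symm w v] at h1
    nlinarith [mul_nonneg hpos.le h, mul_nonneg (sq_nonneg (B T w)) (neg_nonneg.2 hv.le),
      mul_nonneg (sq_nonneg (B T v)) (neg_nonneg.2 hw)]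

theorem apply_nonpos (hB : IsLorentzian B) {T v w : V} (hT : B T T < 0) (hv : B v v ≤ 0)
    (hTv : B T v ≤ 0) (hw : B w w ≤ 0) (hTw : B T w ≤ 0) : B v w ≤ 0 := by
  rcases eq_or_ne v 0 with rfl | hv0
  · simp
  rcases eq_or_ne w 0 with rfl | hw0
  · simp
  replace hTv := lt_of_le_of_ne hTv (hB.apply_ne_zero hT hv0 hv)
  replace hTw := lt_of_le_of_ne hTw (hB.apply_ne_zero hT hw0 hw)
  by_contra! h
  have hu : B T (B T w • v - B T v • w) = 0 := by simp [mul_comm]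
  have hpos : 0 < B T w * B T v := mul_pos_of_neg_of_neg hTw hTv
  have h1 : 0 ≤ B (B T w • v - B T v • w) (B T w • v - B T v • w) := by
    by_cases h0 : B T w • v - B T v • w = 0
    · simp [h0]
    · exact (hB.pos_of_orthogonal hT h0 hu).le
  simp only [map_sub, map_smul, smul_eq_mul, sub_apply,
    smul_apply, hB.symm w v] at h1
  nlinarith [mul_pos hpos h, mul_nonneg (sq_nonneg (B T w)) (neg_nonneg.2 hv),
    mul_nonneg (sq_nonneg (B T v)) (neg_nonneg.2 hw)]

/-- The closed future cone of a Lorentzian form is closed under addition. -/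
theorem add_mem_cone (hB : IsLorentzian B) {T v w : V} (hT : B T T < 0)
    (hv : B v v ≤ 0 ∧ B T v ≤ 0) (hw : B w w ≤ 0 ∧ B T w ≤ 0) :
    B (v + w) (v + w) ≤ 0 ∧ B T (v + w) ≤ 0 := by
  have h := hB.apply_nonpos hT hv.1 hv.2 hw.1 hw.2
  have hv1 := hv.1
  have hw1 := hw.1
  refine ⟨?_, by simpa using add_nonpos hv.2 hw.2⟩
  simp only [map_add, add_apply, hB.symm w v]
  linarith

end IsLorentzian

end LinearAlgebra

/-! ### Widening of metrics, and a metric strictly between two metrics -/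

section Metrics

variable {n : ℕ} {r : ℕ∞} {M : Type*} [TopologicalSpace M]
  [ChartedSpace (EuclideanSpace ℝ (Fin n)) M] [IsManifold (𝓡 n) 1 M]
  {g g' g'' : SpacetimeMetric n r M} {x y z : M}

theorem LorentzMetric.isLorentzian (g : LorentzMetric n r M) (x : M) : IsLorentzian (g.val x) :=
  ⟨g.symm x, g.signature x⟩

theorem ne_zero_of_val_self_neg {g : LorentzMetric n r M} {v : TangentSpace (𝓡 n) x}
    (hv : g.val x v v < 0) : v ≠ 0 := by
  rintro rfl
  simp at hv

theorem FutureTimelike.futureCausal {v : TangentSpace (𝓡 n) x} (h : FutureTimelike g x v) :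
    FutureCausal g x v :=
  ⟨ne_zero_of_val_self_neg h.1, h.1.le, h.2⟩

theorem futureTimelike_orient (g : SpacetimeMetric n r M) (x : M) :
    FutureTimelike g x (g.orient x) :=
  ⟨g.orient_timelike x, g.orient_timelike x⟩

/-- On nonzero vectors the condition defining future causal vectors is closed. -/
theorem futureCausal_iff {v : TangentSpace (𝓡 n) x} :
    FutureCausal g x v ↔ v ≠ 0 ∧ g.val x v v ≤ 0 ∧ g.val x (g.orient x) v ≤ 0 := by
  refine ⟨fun h ↦ ⟨h.1, h.2.1, h.2.2.le⟩, fun h ↦ ⟨h.1, h.2.1, lt_of_le_of_ne h.2.2 ?_⟩⟩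
  exact (g.isLorentzian x).apply_ne_zero (g.orient_timelike x) h.1 h.2.1

theorem FutureTimelike.smul {v : TangentSpace (𝓡 n) x} (h : FutureTimelike g x v) {c : ℝ}
    (hc : 0 < c) : FutureTimelike g x (c • v) := by
  constructor
  · simpa using mul_neg_of_pos_of_neg hc (mul_neg_of_pos_of_neg hc h.1)
  · simpa using mul_neg_of_pos_of_neg hc h.2

theorem FutureCausal.smul {v : TangentSpace (𝓡 n) x} (h : FutureCausal g x v) {c : ℝ}
    (hc : 0 < c) : FutureCausal g x (c • v) := by
  refine ⟨smul_ne_zero hc.ne' h.1, ?_, ?_⟩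
  · simpa using mul_nonpos_of_nonneg_of_nonpos hc.le (mul_nonpos_of_nonneg_of_nonpos hc.le h.2.1)
  · simpa using mul_neg_of_pos_of_neg hc h.2.2

theorem Narrower.trans (h : Narrower g g') (h' : Narrower g' g'') : Narrower g g'' :=
  fun x v hv ↦ h' x v (h x v hv).futureCausal

/-- A vector that is causal for `g`, of either time orientation, is timelike for any wider
metric. -/
theorem Narrower.val_self_neg (h : Narrower g g') {v : TangentSpace (𝓡 n) x} (hv0 : v ≠ 0)
    (hv : g.val x v v ≤ 0) : g'.val x v v < 0 := by
  rcases lt_or_gt_of_ne ((g.isLorentzian x).apply_ne_zero (g.orient_timelike x) hv0 hv) with h1 | h1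
  · exact (h x v ⟨hv0, hv, h1⟩).1
  · have := (h x (-v) ⟨neg_ne_zero.2 hv0, by simpa using hv, by simpa using h1⟩).1
    simpa using this

theorem Narrower.val_self_pos (h : Narrower g g') {v : TangentSpace (𝓡 n) x} (hv0 : v ≠ 0)
    (hv : 0 ≤ g'.val x v v) : 0 < g.val x v v := by
  by_contra! h'
  exact (h.val_self_neg hv0 h').not_ge hv

/-- The sum of two Lorentzian metrics with `g < g'`. It is Lorentzian since it is negative on the
time orientation of `g` and positive definite on its `g'`-orthogonal complement. -/
noncomputable def sumMetric (h : Narrower g g') : SpacetimeMetric n r M where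
  val x := g.val x + g'.val x
  symm x v w := by
    simp only [add_apply]
    rw [g.symm, g'.symm]
  signature x := by
    have hT : (g.val x + g'.val x) (g.orient x) (g.orient x) < 0 :=
      add_neg (g.orient_timelike x) (h x _ (futureTimelike_orient g x).futureCausal).1
    refine ⟨g.orient x, hT, fun w hw hTw ↦ ?_⟩
    refine pos_of_orthogonal_of_pos_on_ker (B := g.val x + g'.val x) (fun v w ↦ ?_)
      (g'.val x (g.orient x)) (fun v hv hφ ↦ ?_) hT hw hTw
    · simp only [add_apply]
      rw [g.symm, g'.symm]
    · have h1 := (g'.isLorentzian x).pos_of_orthogonal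
        (h x _ (futureTimelike_orient g x).futureCausal).1 hv hφ
      exact add_pos (h.val_self_pos hv h1.le) h1
  contMDiff := g.contMDiff.add_section g'.contMDiff
  orient := g.orient
  orient_timelike x :=
    add_neg (g.orient_timelike x) (h x _ (futureTimelike_orient g x).futureCausal).1
  orient_continuous := g.orient_continuous

theorem sumMetric_val (h : Narrower g g') (x : M) (v w : TangentSpace (𝓡 n) x) :
    (sumMetric h).val x v w = g.val x v w + g'.val x v w := rfl

theorem narrower_sumMetric_left (h : Narrower g g') : Narrower g (sumMetric h) := by
  intro x v hv
  have hT := h x _ (futureTimelike_orient g x).futureCausal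
  have hv' := h x v hv
  constructor
  · rw [sumMetric_val]
    exact add_neg_of_nonpos_of_neg hv.2.1 hv'.1
  · rw [sumMetric_val]
    exact add_neg hv.2.2 ((g'.isLorentzian x).apply_neg (g'.orient_timelike x) hT.1 hT.2
      hv'.1.le hv'.2)

theorem narrower_sumMetric_right (h : Narrower g g') : Narrower (sumMetric h) g' := by
  intro x v hv
  have hT := h x _ (futureTimelike_orient g x).futureCausal
  obtain ⟨hv0, hvv, hTv⟩ := hv
  have key : ∀ w : TangentSpace (𝓡 n) x, w ≠ 0 → (sumMetric h).val x w w ≤ 0 →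
      g'.val x w w < 0 := by
    intro w hw0 hw
    by_contra! h1
    have h2 := h.val_self_pos hw0 h1
    rw [sumMetric_val] at hw
    linarith
  have hvv' := key v hv0 hvv
  refine ⟨hvv', ?_⟩
  set T : TangentSpace (𝓡 n) x := g.orient x with hTdef
  have hTT : (sumMetric h).val x T T < 0 := (sumMetric h).orient_timelike x
  have hTv : (sumMetric h).val x T v < 0 := hTv
  -- The ray from `T` in the direction `v` stays in the cone of the sum, hence in that of `g'`,
  -- and therefore cannot cross the `g'`-orthogonal complement of `T`.
  have hneg : g'.val x T v < 0 := by
    by_contra! h1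
    have h1 : 0 < g'.val x T v :=
      lt_of_le_of_ne h1 ((g'.isLorentzian x).apply_ne_zero hT.1 hv0 hvv'.le).symm
    set s : ℝ := -g'.val x T T / g'.val x T v with hs
    have hspos : 0 < s := div_pos (neg_pos.2 hT.1) h1
    have horth : g'.val x T (T + s • v) = 0 := by
      simp only [map_add, map_smul, smul_eq_mul, hs]
      field_simp
      ring
    have hww : (sumMetric h).val x (T + s • v) (T + s • v) < 0 := by
      have hsymm := (sumMetric h).symm x v T
      simp only [map_add, map_smul, smul_eq_mul, add_apply,
        smul_apply, hsymm]
      nlinarith [mul_pos hspos (neg_pos.2 hTv), mul_nonneg (mul_nonneg hspos.le hspos.le)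
        (neg_nonneg.2 hvv)]
    have hw0 := ne_zero_of_val_self_neg hww
    exact ((g'.isLorentzian x).pos_of_orthogonal hT.1 hw0 horth).not_gt (key _ hw0 hww.le)
  have hT2 : g'.val x T (g'.orient x) < 0 := by
    rw [g'.symm]
    exact hT.2
  exact (g'.isLorentzian x).apply_neg hT.1 (g'.orient_timelike x) hT2 hvv'.le hneg

theorem Narrower.exists_between (h : Narrower g g') :
    ∃ h' : SpacetimeMetric n r M, Narrower g h' ∧ Narrower h' g' :=
  ⟨sumMetric h, narrower_sumMetric_left h, narrower_sumMetric_right h⟩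

end Metrics

/-! ### Causal curves and time reversal -/

section Reparametrization

variable {n : ℕ} {M : Type*} [TopologicalSpace M] [ChartedSpace (EuclideanSpace ℝ (Fin n)) M]
  {γ : ℝ → M} {a b : ℝ}

theorem mfderivWithin_Icc_restrict (h : ContMDiffOn 𝓘(ℝ, ℝ) (𝓡 n) 1 γ (Icc a b)) {c d : ℝ}
    (hsub : Icc c d ⊆ Icc a b) (hcd : c < d) {t : ℝ} (ht : t ∈ Icc c d) :
    mfderivWithin 𝓘(ℝ, ℝ) (𝓡 n) γ (Icc c d) t = mfderivWithin 𝓘(ℝ, ℝ) (𝓡 n) γ (Icc a b) t :=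
  mfderivWithin_subset hsub ((uniqueDiffOn_Icc hcd).uniqueMDiffOn t ht)
    ((h t (hsub ht)).mdifferentiableWithinAt one_ne_zero)

theorem contMDiffOn_comp_neg (h : ContMDiffOn 𝓘(ℝ, ℝ) (𝓡 n) 1 γ (Icc a b)) :
    ContMDiffOn 𝓘(ℝ, ℝ) (𝓡 n) 1 (fun t ↦ γ (-t)) (Icc (-b) (-a)) :=
  h.comp contDiff_neg.contMDiff.contMDiffOn fun _ ht ↦ ⟨le_neg.1 ht.2, neg_le.1 ht.1⟩

theorem mfderivWithin_comp_neg (hab : a < b) (h : ContMDiffOn 𝓘(ℝ, ℝ) (𝓡 n) 1 γ (Icc a b))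
    {t : ℝ} (ht : t ∈ Icc (-b) (-a)) :
    mfderivWithin 𝓘(ℝ, ℝ) (𝓡 n) (fun t ↦ γ (-t)) (Icc (-b) (-a)) t (1 : ℝ)
      = -mfderivWithin 𝓘(ℝ, ℝ) (𝓡 n) γ (Icc a b) (-t) (1 : ℝ) := by
  have hmaps : MapsTo (fun t : ℝ ↦ -t) (Icc (-b) (-a)) (Icc a b) :=
    fun _ ht ↦ ⟨le_neg.1 ht.2, neg_le.1 ht.1⟩
  have h1 : HasMFDerivWithinAt 𝓘(ℝ, ℝ) (𝓡 n) γ (Icc a b) (-t)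
      (mfderivWithin 𝓘(ℝ, ℝ) (𝓡 n) γ (Icc a b) (-t)) :=
    ((h (-t) (hmaps ht)).mdifferentiableWithinAt one_ne_zero).hasMFDerivWithinAt
  have h2 : HasMFDerivWithinAt 𝓘(ℝ, ℝ) 𝓘(ℝ, ℝ) (fun t : ℝ ↦ -t) (Icc (-b) (-a)) t
      (-ContinuousLinearMap.id ℝ ℝ) :=
    ((hasFDerivAt_id t).neg.hasFDerivWithinAt).hasMFDerivWithinAt
  have h3 := (HasMFDerivWithinAt.comp t h1 h2 hmaps).mfderivWithin
    ((uniqueDiffOn_Icc (neg_lt_neg hab)).uniqueMDiffOn t ht)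
  have h4 := congrArg (fun L ↦ L (1 : ℝ)) h3
  refine h4.trans ?_
  exact map_neg (mfderivWithin 𝓘(ℝ, ℝ) (𝓡 n) γ (Icc a b) (-t)) (1 : ℝ)

end Reparametrization

section Curves

variable {n : ℕ} {r : ℕ∞} {M : Type*} [TopologicalSpace M]
  [ChartedSpace (EuclideanSpace ℝ (Fin n)) M] [IsManifold (𝓡 n) 1 M]
  {g g' : SpacetimeMetric n r M} {x y z : M} {γ : ℝ → M} {a b : ℝ}

theorem IsTimelikeCurveOn.isCausalCurveOn (h : IsTimelikeCurveOn g γ a b) :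
    IsCausalCurveOn g γ a b :=
  ⟨h.1, fun t ht ↦ (h.2 t ht).futureCausal⟩

theorem TimelikeSegment.causalSegment (h : TimelikeSegment g x z) : CausalSegment g x z := by
  obtain ⟨γ, a, b, hab, ha, hb, hγ⟩ := h
  exact ⟨γ, a, b, hab, ha, hb, hγ.isCausalCurveOn⟩

theorem CausalSegment.timelikeSegment_of_narrower (hg : Narrower g g')
    (h : CausalSegment g x z) : TimelikeSegment g' x z := by
  obtain ⟨γ, a, b, hab, ha, hb, hγ⟩ := h
  exact ⟨γ, a, b, hab, ha, hb, hγ.1, fun t ht ↦ hg _ _ (hγ.2 t ht)⟩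

theorem causalCurveJoins_of_I (h : I g x z) : CausalCurveJoins g x z :=
  Relation.TransGen.mono (fun _ _ ↦ TimelikeSegment.causalSegment) _ _ h

theorem I_of_causalCurveJoins_of_narrower (hg : Narrower g g') (h : CausalCurveJoins g x z) :
    I g' x z :=
  Relation.TransGen.mono (fun _ _ ↦ CausalSegment.timelikeSegment_of_narrower hg) _ _ h

theorem J_of_I (h : I g x z) : J g x z := Or.inr (causalCurveJoins_of_I h)

theorem J.trans (h : J g x y) (h' : J g y z) : J g x z := by
  rcases h with rfl | h
  · exact h'
  rcases h' with rfl | h'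
  · exact Or.inr h
  · exact Or.inr (Relation.TransGen.trans h h')

theorem IsCausalCurveOn.restrict (h : IsCausalCurveOn g γ a b) {c d : ℝ} (hac : a ≤ c)
    (hcd : c < d) (hdb : d ≤ b) : IsCausalCurveOn g γ c d := by
  have hsub : Icc c d ⊆ Icc a b := Icc_subset_Icc hac hdb
  refine ⟨h.1.mono hsub, fun t ht ↦ ?_⟩
  rw [mfderivWithin_Icc_restrict h.1 hsub hcd ht]
  exact h.2 t (hsub ht)

theorem IsTimelikeCurveOn.restrict (h : IsTimelikeCurveOn g γ a b) {c d : ℝ} (hac : a ≤ c)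
    (hcd : c < d) (hdb : d ≤ b) : IsTimelikeCurveOn g γ c d := by
  have hsub : Icc c d ⊆ Icc a b := Icc_subset_Icc hac hdb
  refine ⟨h.1.mono hsub, fun t ht ↦ ?_⟩
  rw [mfderivWithin_Icc_restrict h.1 hsub hcd ht]
  exact h.2 t (hsub ht)

/-- A timelike segment is not constant, hence passes through a point other than its
starting point. -/
theorem TimelikeSegment.exists_ne (h : TimelikeSegment g x z) :
    ∃ y, y ≠ x ∧ TimelikeSegment g x y ∧ (y = z ∨ TimelikeSegment g y z) := by
  obtain ⟨γ, a, b, hab, rfl, rfl, hγ⟩ := h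
  obtain ⟨t, ht, hne⟩ : ∃ t ∈ Icc a b, γ t ≠ γ a := by
    by_contra! hconst
    have ha : a ∈ Icc a b := left_mem_Icc.2 hab.le
    have h1 := (hγ.2 a ha).1
    have h2 : mfderivWithin 𝓘(ℝ, ℝ) (𝓡 n) γ (Icc a b) a = 0 := by
      rw [mfderivWithin_congr (f := fun _ ↦ γ a) hconst rfl]
      exact mfderivWithin_const
    rw [h2] at h1
    exact ne_zero_of_val_self_neg h1 rfl
  have hat : a < t := lt_of_le_of_ne ht.1 (by rintro rfl; exact hne rfl)
  refine ⟨γ t, hne, ⟨γ, a, t, hat, rfl, rfl, hγ.restrict le_rfl hat ht.2⟩, ?_⟩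
  rcases ht.2.eq_or_lt with rfl | htb
  · exact Or.inl rfl
  · exact Or.inr ⟨γ, t, b, htb, rfl, rfl, hγ.restrict ht.1 htb le_rfl⟩

/-- A closed timelike curve passes through two distinct points, each in the chronological future
of the other. -/
theorem exists_ne_of_I_self (h : I g x x) : ∃ y, y ≠ x ∧ I g x y ∧ I g y x := by
  rcases Relation.TransGen.head'_iff.1 h with ⟨m, hxm, hmx⟩
  obtain ⟨y, hyx, hxy, hym⟩ := hxm.exists_ne
  refine ⟨y, hyx, Relation.TransGen.single hxy, ?_⟩
  rcases hym with rfl | hym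
  · rcases Relation.reflTransGen_iff_eq_or_transGen.1 hmx with h | h
    · exact absurd h.symm hyx
    · exact h
  · exact Relation.TransGen.head' hym hmx

variable (g) in
/-- The same metric with the opposite time orientation. -/
noncomputable def SpacetimeMetric.reverse : SpacetimeMetric n r M where
  toLorentzMetric := g.toLorentzMetric
  orient x := -g.orient x
  orient_timelike x := by simpa using g.orient_timelike x
  orient_continuous := by
    have h : ContMDiff (𝓡 n) ((𝓡 n).prod 𝓘(ℝ, EuclideanSpace ℝ (Fin n))) 0
        (fun x : M ↦ (TotalSpace.mk' (EuclideanSpace ℝ (Fin n)) x (g.orient x) :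
          TangentBundle (𝓡 n) M)) := contMDiff_zero_iff.2 g.orient_continuous
    exact contMDiff_zero_iff.1 h.neg_section

theorem futureTimelike_reverse {v : TangentSpace (𝓡 n) x} :
    FutureTimelike g.reverse x v ↔ FutureTimelike g x (-v) := by
  simp [FutureTimelike, SpacetimeMetric.reverse]

theorem futureCausal_reverse {v : TangentSpace (𝓡 n) x} :
    FutureCausal g.reverse x v ↔ FutureCausal g x (-v) := by
  simp [FutureCausal, SpacetimeMetric.reverse]

theorem Narrower.reverse (h : Narrower g g') : Narrower g.reverse g'.reverse :=
  fun x _ hv ↦ futureTimelike_reverse.2 (h x _ (futureCausal_reverse.1 hv))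

theorem TimelikeSegment.reverse (h : TimelikeSegment g x z) :
    TimelikeSegment g.reverse z x := by
  obtain ⟨γ, a, b, hab, rfl, rfl, hγ⟩ := h
  refine ⟨fun t ↦ γ (-t), -b, -a, neg_lt_neg hab, by simp, by simp,
    contMDiffOn_comp_neg hγ.1, fun t ht ↦ ?_⟩
  rw [mfderivWithin_comp_neg hab hγ.1 ht, futureTimelike_reverse, neg_neg]
  exact hγ.2 (-t) ⟨le_neg.1 ht.2, neg_le.1 ht.1⟩

theorem CausalSegment.reverse (h : CausalSegment g x z) : CausalSegment g.reverse z x := by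
  obtain ⟨γ, a, b, hab, rfl, rfl, hγ⟩ := h
  refine ⟨fun t ↦ γ (-t), -b, -a, neg_lt_neg hab, by simp, by simp,
    contMDiffOn_comp_neg hγ.1, fun t ht ↦ ?_⟩
  rw [mfderivWithin_comp_neg hab hγ.1 ht, futureCausal_reverse, neg_neg]
  exact hγ.2 (-t) ⟨le_neg.1 ht.2, neg_le.1 ht.1⟩

theorem reverse_reverse (g : SpacetimeMetric n r M) : g.reverse.reverse = g := by
  cases g
  simp [SpacetimeMetric.reverse]

theorem I_reverse (h : I g.reverse x z) : I g z x := by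
  refine Relation.transGen_swap.1 (Relation.TransGen.mono (fun p q hpq ↦ ?_) _ _ h)
  have := hpq.reverse
  rwa [reverse_reverse] at this

theorem CausalCurveJoins.reverse (h : CausalCurveJoins g x z) :
    CausalCurveJoins g.reverse z x :=
  Relation.TransGen.mono (fun _ _ (hpq : CausalSegment g _ _) ↦ hpq.reverse) _ _
    (Relation.transGen_swap.2 h)

theorem I_reverse_iff : I g.reverse x z ↔ I g z x := by
  refine ⟨I_reverse, fun h ↦ I_reverse ?_⟩
  rwa [reverse_reverse]

theorem IsCausal.reverse (h : IsCausal g) : IsCausal g.reverse := by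
  intro x hx
  have h1 := hx.reverse
  rw [reverse_reverse] at h1
  exact h x h1

end Curves

/-! ### Comparison of the light cones at nearby points -/

section Cones

variable {n : ℕ} {r : ℕ∞} {M : Type*} [TopologicalSpace M]
  [ChartedSpace (EuclideanSpace ℝ (Fin n)) M] [IsManifold (𝓡 n) 1 M]
  {g g' : SpacetimeMetric n r M} {x y z : M}

/-- A constant vector `v` in the chart at `x`, seen as a tangent vector at the point `y` of the
chart domain (and `0` if `y` lies outside). -/
noncomputable def chartVector (x y : M) : EuclideanSpace ℝ (Fin n) →L[ℝ] TangentSpace (𝓡 n) y :=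
  (trivializationAt (EuclideanSpace ℝ (Fin n)) (TangentSpace (𝓡 n)) x).symmL ℝ y

theorem mem_baseSet_of_mem_source (hy : y ∈ (chartAt (EuclideanSpace ℝ (Fin n)) x).source) :
    y ∈ (trivializationAt (EuclideanSpace ℝ (Fin n)) (TangentSpace (𝓡 n) : M → Type _) x).baseSet :=
  hy

theorem chartVector_mfderiv (hy : y ∈ (chartAt (EuclideanSpace ℝ (Fin n)) x).source)
    (v : TangentSpace (𝓡 n) y) :
    chartVector x y (mfderiv (𝓡 n) 𝓘(ℝ, EuclideanSpace ℝ (Fin n)) (extChartAt (𝓡 n) x) y v) = v := by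
  rw [← TangentBundle.continuousLinearMapAt_trivializationAt hy]
  exact Bundle.Trivialization.symmL_continuousLinearMapAt _ (mem_baseSet_of_mem_source hy) v

theorem chartVector_injective (hy : y ∈ (chartAt (EuclideanSpace ℝ (Fin n)) x).source) :
    Function.Injective (chartVector (n := n) x y) :=
  Function.LeftInverse.injective (g :=
    (trivializationAt (EuclideanSpace ℝ (Fin n)) (TangentSpace (𝓡 n)) x).continuousLinearMapAt ℝ y)
    fun v ↦ Bundle.Trivialization.continuousLinearMapAt_symmL _ (mem_baseSet_of_mem_source hy) v

theorem continuousOn_chartVector (x : M) :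
    ContinuousOn (fun p : M × EuclideanSpace ℝ (Fin n) ↦
      (TotalSpace.mk' (EuclideanSpace ℝ (Fin n)) p.1 (chartVector x p.1 p.2) :
        TangentBundle (𝓡 n) M)) ((chartAt (EuclideanSpace ℝ (Fin n)) x).source ×ˢ univ) := by
  let e := trivializationAt (EuclideanSpace ℝ (Fin n)) (TangentSpace (𝓡 n) : M → Type _) x
  refine e.continuousOn_symm.congr fun p hp ↦ ?_
  exact congrArg (TotalSpace.mk p.1) (e.symmL_apply (R := ℝ) hp.1 p.2)

theorem continuousOn_val_chartVector (g : LorentzMetric n r M) (x : M) :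
    ContinuousOn (fun p : M × EuclideanSpace ℝ (Fin n) ↦
      g.val p.1 (chartVector x p.1 p.2) (chartVector x p.1 p.2))
      ((chartAt (EuclideanSpace ℝ (Fin n)) x).source ×ˢ univ) := by
  have h1 := continuousOn_chartVector (n := n) x
  have h2 := g.contMDiff.continuous.comp_continuousOn
    (continuousOn_fst (s := (chartAt (EuclideanSpace ℝ (Fin n)) x).source ×ˢ
      (univ : Set (EuclideanSpace ℝ (Fin n)))))
  have h3 := ContinuousOn.clm_bundle_apply₂ (E₃ := Bundle.Trivial M ℝ) (F₃ := ℝ) h2 h1 h1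
  exact (continuous_snd.comp (Bundle.Trivial.homeomorphProd M ℝ).continuous).comp_continuousOn h3

theorem continuousOn_val_orient_chartVector (g : SpacetimeMetric n r M) (x : M) :
    ContinuousOn (fun p : M × EuclideanSpace ℝ (Fin n) ↦
      g.val p.1 (g.orient p.1) (chartVector x p.1 p.2))
      ((chartAt (EuclideanSpace ℝ (Fin n)) x).source ×ˢ univ) := by
  have hfst := continuousOn_fst (s := (chartAt (EuclideanSpace ℝ (Fin n)) x).source ×ˢ
      (univ : Set (EuclideanSpace ℝ (Fin n))))
  have h3 := ContinuousOn.clm_bundle_apply₂ (E₃ := Bundle.Trivial M ℝ) (F₃ := ℝ)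
    (g.contMDiff.continuous.comp_continuousOn hfst) (g.orient_continuous.comp_continuousOn hfst)
    (continuousOn_chartVector (n := n) x)
  exact (continuous_snd.comp (Bundle.Trivial.homeomorphProd M ℝ).continuous).comp_continuousOn h3

theorem eventually_futureTimelike_chartVector {v : EuclideanSpace ℝ (Fin n)}
    (h : FutureTimelike g x (chartVector x x v)) :
    ∀ᶠ p : M × EuclideanSpace ℝ (Fin n) in 𝓝 (x, v),
      FutureTimelike g p.1 (chartVector x p.1 p.2) := by
  have h1 := (continuousOn_val_chartVector g.toLorentzMetric x).continuousAt
    (prod_mem_nhds (chart_source_mem_nhds _ x) (Filter.univ_mem (f := 𝓝 v)))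
  have h2 := (continuousOn_val_orient_chartVector g x).continuousAt
    (prod_mem_nhds (chart_source_mem_nhds _ x) (Filter.univ_mem (f := 𝓝 v)))
  exact (h1.eventually_lt_const h.1).and (h2.eventually_lt_const h.2)

theorem eventually_not_futureCausal_chartVector {v : EuclideanSpace ℝ (Fin n)} (hv : v ≠ 0)
    (h : ¬ FutureCausal g x (chartVector x x v)) :
    ∀ᶠ p : M × EuclideanSpace ℝ (Fin n) in 𝓝 (x, v),
      ¬ FutureCausal g p.1 (chartVector x p.1 p.2) := by
  have h1 := (continuousOn_val_chartVector g.toLorentzMetric x).continuousAt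
    (prod_mem_nhds (chart_source_mem_nhds _ x) (Filter.univ_mem (f := 𝓝 v)))
  have h2 := (continuousOn_val_orient_chartVector g x).continuousAt
    (prod_mem_nhds (chart_source_mem_nhds _ x) (Filter.univ_mem (f := 𝓝 v)))
  have hv' : chartVector x x v ≠ 0 := fun h0 ↦
    hv (chartVector_injective (mem_chart_source _ x) (h0.trans (map_zero _).symm))
  rw [futureCausal_iff, not_and, not_and_or, not_le, not_le] at h
  rcases h hv' with h | h
  · filter_upwards [h1.eventually_const_lt h] with p hp hp'
    exact hp'.2.1.not_gt hp
  · filter_upwards [h2.eventually_const_lt h] with p hp hp'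
    exact hp'.2.2.le.not_gt hp

/-- The closed future cone of `g` at `x`, as a closed convex cone in the chart at `x`. -/
noncomputable def futureCone (g : SpacetimeMetric n r M) (x : M) :
    ProperCone ℝ (EuclideanSpace ℝ (Fin n)) where
  carrier := {v | g.val x (chartVector x x v) (chartVector x x v) ≤ 0 ∧
    g.val x (g.orient x) (chartVector x x v) ≤ 0}
  add_mem' {v w} hv hw := by
    have h : chartVector x x (v + w) = chartVector x x v + chartVector x x w :=
      map_add (chartVector (n := n) x x) v w
    simp only [mem_ofPred_eq, h]
    exact (g.isLorentzian x).add_mem_cone (g.orient_timelike x) hv hw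
  zero_mem' := by simp
  smul_mem' := by
    rintro ⟨c, hc⟩ v ⟨hv1, hv2⟩
    have h : chartVector x x ((⟨c, hc⟩ : {c : ℝ // 0 ≤ c}) • v) = c • chartVector x x v :=
      map_smul (chartVector (n := n) x x) c v
    simp only [mem_ofPred_eq, h, map_smul, smul_apply, smul_eq_mul]
    exact ⟨mul_nonpos_of_nonneg_of_nonpos hc (mul_nonpos_of_nonneg_of_nonpos hc hv1),
      mul_nonpos_of_nonneg_of_nonpos hc hv2⟩
  isClosed' := by
    have h1 : Continuous fun v : EuclideanSpace ℝ (Fin n) ↦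
        g.val x (chartVector x x v) (chartVector x x v) := by
      have h := (continuousOn_val_chartVector g.toLorentzMetric x).comp_continuous
        (Continuous.prodMk_right x) fun v ↦ ⟨mem_chart_source _ x, mem_univ v⟩
      exact h
    have h2 : Continuous fun v : EuclideanSpace ℝ (Fin n) ↦
        g.val x (g.orient x) (chartVector x x v) := by
      have h := (continuousOn_val_orient_chartVector g x).comp_continuous
        (Continuous.prodMk_right x) fun v ↦ ⟨mem_chart_source _ x, mem_univ v⟩
      exact h
    exact (isClosed_le h1 continuous_const).inter (isClosed_le h2 continuous_const)

theorem mem_futureCone_iff {v : EuclideanSpace ℝ (Fin n)} (hv : v ≠ 0) :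
    v ∈ futureCone g x ↔ FutureCausal g x (chartVector x x v) := by
  have hv' : chartVector x x v ≠ 0 := fun h0 ↦
    hv (chartVector_injective (mem_chart_source _ x) (h0.trans (map_zero _).symm))
  rw [futureCausal_iff]
  exact ⟨fun h ↦ ⟨hv', h⟩, fun h ↦ h.2⟩

/-- If `g < g'`, then in the chart at `x` the `g`-causal vectors at points near `x` lie in the
future cone of `g'` at `x`. -/
theorem Narrower.eventually_mem_futureCone (h : Narrower g g') (x : M) :
    ∀ᶠ y in 𝓝 x, ∀ v : EuclideanSpace ℝ (Fin n), FutureCausal g y (chartVector x y v) →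
      v ∈ futureCone g' x := by
  have key : ∀ᶠ y in 𝓝 x, ∀ v ∈ Metric.sphere (0 : EuclideanSpace ℝ (Fin n)) 1,
      FutureCausal g y (chartVector x y v) → v ∈ futureCone g' x := by
    refine (isCompact_sphere _ _).eventually_forall_of_forall_eventually fun v hv ↦ ?_
    have hv0 : v ≠ 0 := Metric.ne_of_mem_sphere hv one_ne_zero
    by_cases hc : FutureCausal g x (chartVector x x v)
    · have h1 := eventually_futureTimelike_chartVector (h x _ hc)
      have h2 : ∀ᶠ w in 𝓝 v, FutureTimelike g' x (chartVector x x w) :=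
        (Continuous.prodMk_right x).continuousAt.eventually h1
      have h3 : ∀ᶠ w in 𝓝 v, w ∈ futureCone g' x :=
        h2.mono fun w hw ↦ ⟨hw.1.le, hw.2.le⟩
      exact (continuous_snd.continuousAt.eventually h3).mono fun p hp _ ↦ hp
    · exact (eventually_not_futureCausal_chartVector hv0 hc).mono fun p hp hp' ↦ absurd hp' hp
  filter_upwards [key] with y hy v hv
  have hv0 : v ≠ 0 := by
    rintro rfl
    exact hv.1 (map_zero _)
  have hn : 0 < ‖v‖ := norm_pos_iff.2 hv0
  have h1 : ‖v‖⁻¹ • v ∈ futureCone g' x := by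
    refine hy _ (by simp [norm_smul, hn.ne']) ?_
    rw [map_smul]
    exact hv.smul (inv_pos.2 hn)
  have h2 := (futureCone g' x).smul_mem h1 hn.le
  rwa [smul_smul, mul_inv_cancel₀ hn.ne', one_smul] at h2

/-- If `g < g'`, then in the chart at `x` a uniform angular neighborhood of the future cone of `g`
at `x` consists of vectors that are `g'`-timelike at all points near `x`. -/
theorem Narrower.exists_forall_near_futureCone (h : Narrower g g') (x : M) :
    ∃ δ > 0, ∀ᶠ y in 𝓝 x, ∀ v ∈ futureCone g x, v ≠ 0 → ∀ w : EuclideanSpace ℝ (Fin n),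
      ‖w - v‖ < δ * ‖v‖ → FutureTimelike g' y (chartVector x y w) := by
  have key : ∀ᶠ p : M × EuclideanSpace ℝ (Fin n) in 𝓝 (x, 0),
      ∀ v ∈ Metric.sphere (0 : EuclideanSpace ℝ (Fin n)) 1 ∩ futureCone g x,
        FutureTimelike g' p.1 (chartVector x p.1 (v + p.2)) := by
    refine ((isCompact_sphere _ _).inter_right
      (futureCone g x).isClosed).eventually_forall_of_forall_eventually fun v hv ↦ ?_
    have hv0 : v ≠ 0 := Metric.ne_of_mem_sphere hv.1 one_ne_zero
    have h1 := eventually_futureTimelike_chartVector (h x _ ((mem_futureCone_iff hv0).1 hv.2))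
    have h2 : Filter.Tendsto (fun q : (M × EuclideanSpace ℝ (Fin n)) × EuclideanSpace ℝ (Fin n) ↦
        (q.1.1, q.2 + q.1.2)) (𝓝 ((x, 0), v)) (𝓝 (x, v)) := by
      have h3 : Continuous fun q : (M × EuclideanSpace ℝ (Fin n)) × EuclideanSpace ℝ (Fin n) ↦
        (q.1.1, q.2 + q.1.2) := by fun_prop
      simpa using h3.tendsto ((x, 0), v)
    exact h2.eventually h1
  rw [nhds_prod_eq] at key
  obtain ⟨P, hP, Q, hQ, hPQ⟩ := Filter.eventually_prod_iff.1 key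
  obtain ⟨δ, hδ, hball⟩ := Metric.eventually_nhds_iff.1 hQ
  refine ⟨δ, hδ, hP.mono fun y hy v hv hv0 w hw ↦ ?_⟩
  have hn : 0 < ‖v‖ := norm_pos_iff.2 hv0
  have hQw : Q (‖v‖⁻¹ • (w - v)) := by
    apply hball
    rw [dist_zero_right, norm_smul, norm_inv, norm_norm, inv_mul_lt_iff₀ hn, mul_comm]
    exact hw
  have h1 := hPQ hy hQw (‖v‖⁻¹ • v) ⟨by simp [norm_smul, hn.ne'],
    (futureCone g x).smul_mem hv (inv_nonneg.2 hn.le)⟩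
  have h2 := h1.smul hn
  rw [← map_smul] at h2
  simpa [smul_smul, hn.ne', ← smul_add] using h2

end Cones

/-! ### Moving the endpoint of a causal curve by widening the cones -/

/-- A curve in a normed space whose velocity lies in a closed convex cone has its displacement in
that cone: every linear functional that is nonnegative on the cone is monotone along the curve. -/
theorem sub_mem_of_hasDerivWithinAt_mem {E : Type*} [NormedAddCommGroup E] [NormedSpace ℝ E]
    (C : ProperCone ℝ E) {c v : ℝ → E} {a b : ℝ} (hab : a ≤ b)
    (hd : ∀ t ∈ Icc a b, HasDerivWithinAt c (v t) (Icc a b) t) (hv : ∀ t ∈ Icc a b, v t ∈ C) :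
    c b - c a ∈ C := by
  by_contra hmem
  obtain ⟨f, hf, hneg⟩ := C.hyperplane_separation_point hmem
  have hmono : MonotoneOn (fun t ↦ f (c t)) (Icc a b) := by
    refine monotoneOn_of_hasDerivWithinAt_nonneg (convex_Icc a b) (f' := fun t ↦ f (v t)) ?_ ?_ ?_
    · exact fun t ht ↦ f.continuous.continuousAt.comp_continuousWithinAt
        (hd t ht).continuousWithinAt
    · exact fun t ht ↦ (f.hasFDerivAt.comp_hasDerivWithinAt t (hd t (interior_subset ht))).mono
        interior_subset
    · exact fun t ht ↦ hf _ (hv t (interior_subset ht))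
  have h := hmono (left_mem_Icc.2 hab) (right_mem_Icc.2 hab) hab
  rw [map_sub] at hneg
  simp only at h
  linarith

section Tilt

variable {n : ℕ} {r : ℕ∞} {M : Type*} [TopologicalSpace M]
  [ChartedSpace (EuclideanSpace ℝ (Fin n)) M] [IsManifold (𝓡 n) 1 M]
  {g g' : SpacetimeMetric n r M} {x y z p q : M} {γ : ℝ → M} {a b : ℝ}

/-- Along a causal curve whose velocity, read in the chart at `x`, stays in a closed convex cone,
the coordinate displacement lies in that cone. -/
theorem IsCausalCurveOn.extChartAt_sub_mem (hγ : IsCausalCurveOn g γ a b) (hab : a ≤ b)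
    {C : ProperCone ℝ (EuclideanSpace ℝ (Fin n))}
    (hsource : ∀ t ∈ Icc a b, γ t ∈ (chartAt (EuclideanSpace ℝ (Fin n)) x).source)
    (hC : ∀ t ∈ Icc a b, ∀ v, FutureCausal g (γ t) (chartVector x (γ t) v) → v ∈ C) :
    extChartAt (𝓡 n) x (γ b) - extChartAt (𝓡 n) x (γ a) ∈ C := by
  have hder : ∀ t ∈ Icc a b, ∃ v ∈ C,
      HasDerivWithinAt (fun t ↦ extChartAt (𝓡 n) x (γ t)) v (Icc a b) t := by
    intro t ht
    have h1 := ((hγ.1 t ht).mdifferentiableWithinAt one_ne_zero).hasMFDerivWithinAt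
    have h2 := (mdifferentiableAt_extChartAt (I := 𝓡 n) (hsource t ht)).hasMFDerivAt
    have h3 := (h2.comp_hasMFDerivWithinAt t h1).hasFDerivWithinAt
    obtain ⟨L, hL, hL1⟩ : ∃ L : ℝ →L[ℝ] EuclideanSpace ℝ (Fin n),
        HasFDerivWithinAt (fun t ↦ extChartAt (𝓡 n) x (γ t)) L (Icc a b) t ∧
        chartVector x (γ t) (L 1) = mfderivWithin 𝓘(ℝ, ℝ) (𝓡 n) γ (Icc a b) t (1 : ℝ) :=
      ⟨_, h3, chartVector_mfderiv (hsource t ht) _⟩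
    refine ⟨L 1, hC t ht _ ?_, hL.hasDerivWithinAt⟩
    rw [hL1]
    exact hγ.2 t ht
  choose! v hv hd using hder
  exact sub_mem_of_hasDerivWithinAt_mem C hab hd hv

/-- A causal segment starting in an open set `B` inside a closed set `K` of a chart domain either
stays in `B` or has a first exit point `z`; up to that point the coordinate displacement lies in
any closed convex cone which contains the causal vectors at the points of `K`. -/
theorem CausalSegment.exists_exit {C : ProperCone ℝ (EuclideanSpace ℝ (Fin n))} {B K : Set M}
    (hB : IsOpen B) (hK : IsClosed K) (hBK : B ⊆ K)
    (hsource : K ⊆ (chartAt (EuclideanSpace ℝ (Fin n)) x).source)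
    (hC : ∀ y ∈ K, ∀ v, FutureCausal g y (chartVector x y v) → v ∈ C)
    (hp : p ∈ B) (h : CausalSegment g p q) :
    ∃ z ∈ K, extChartAt (𝓡 n) x z - extChartAt (𝓡 n) x p ∈ C ∧
      ((z ∈ B ∧ z = q) ∨ (z ∉ B ∧ J g z q)) := by
  obtain ⟨γ, a, b, hab, rfl, rfl, hγ⟩ := h
  have hcont : ContinuousOn γ (Icc a b) := hγ.1.continuousOn
  by_cases hall : ∀ t ∈ Icc a b, γ t ∈ B
  · have hb := hall b (right_mem_Icc.2 hab.le)
    refine ⟨γ b, hBK hb, ?_, Or.inl ⟨hb, rfl⟩⟩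
    exact hγ.extChartAt_sub_mem hab.le (fun t ht ↦ hsource (hBK (hall t ht)))
      fun t ht ↦ hC _ (hBK (hall t ht))
  · push Not at hall
    obtain ⟨t₁, ht₁, ht₁B⟩ := hall
    have hS : IsClosed (Icc a b ∩ γ ⁻¹' Bᶜ) :=
      hcont.preimage_isClosed_of_isClosed isClosed_Icc hB.isClosed_compl
    have hbdd : BddBelow (Icc a b ∩ γ ⁻¹' Bᶜ) := bddBelow_Icc.mono inter_subset_left
    have hmem := hS.csInf_mem ⟨t₁, ht₁, ht₁B⟩ hbdd
    set t₀ := sInf (Icc a b ∩ γ ⁻¹' Bᶜ) with ht₀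
    have hlt : ∀ t ∈ Ico a t₀, γ t ∈ B := by
      intro t ht
      by_contra htB
      exact (csInf_le hbdd ⟨⟨ht.1, ht.2.le.trans hmem.1.2⟩, htB⟩).not_gt ht.2
    have hat : a < t₀ := lt_of_le_of_ne hmem.1.1 fun hEq ↦ hmem.2 (hEq ▸ hp)
    have hT : IsClosed (Icc a b ∩ γ ⁻¹' K) :=
      hcont.preimage_isClosed_of_isClosed isClosed_Icc hK
    have hIcc : Icc a t₀ ⊆ Icc a b ∩ γ ⁻¹' K := by
      rw [← closure_Ico hat.ne]
      exact closure_minimal (fun t ht ↦ ⟨⟨ht.1, ht.2.le.trans hmem.1.2⟩, hBK (hlt t ht)⟩) hT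
    refine ⟨γ t₀, (hIcc (right_mem_Icc.2 hat.le)).2, ?_, Or.inr ⟨hmem.2, ?_⟩⟩
    · exact (hγ.restrict le_rfl hat hmem.1.2).extChartAt_sub_mem hat.le
        (fun t ht ↦ hsource (hIcc ht).2) fun t ht ↦ hC _ (hIcc ht).2
    · rcases hmem.1.2.eq_or_lt with heq | htb
      · exact Or.inl (congrArg γ heq)
      · exact Or.inr (Relation.TransGen.single
          ⟨γ, t₀, b, htb, rfl, rfl, hγ.restrict hmem.1.1 htb le_rfl⟩)

theorem CausalCurveJoins.exists_exit {C : ProperCone ℝ (EuclideanSpace ℝ (Fin n))} {B K : Set M}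
    (hB : IsOpen B) (hK : IsClosed K) (hBK : B ⊆ K)
    (hsource : K ⊆ (chartAt (EuclideanSpace ℝ (Fin n)) x).source)
    (hC : ∀ y ∈ K, ∀ v, FutureCausal g y (chartVector x y v) → v ∈ C)
    (hp : p ∈ B) (hq : q ∉ B) (h : CausalCurveJoins g p q) :
    ∃ z ∈ K, z ∉ B ∧ extChartAt (𝓡 n) x z - extChartAt (𝓡 n) x p ∈ C ∧ J g z q := by
  induction h using Relation.TransGen.head_induction_on with
  | single h =>
    obtain ⟨z, hzK, hzC, ⟨hzB, rfl⟩ | ⟨hzB, hz⟩⟩ := h.exists_exit hB hK hBK hsource hC hp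
    · exact absurd hzB hq
    · exact ⟨z, hzK, hzB, hzC, hz⟩
  | head h h' ih =>
    obtain ⟨z, hzK, hzC, ⟨hzB, rfl⟩ | ⟨hzB, hz⟩⟩ := h.exists_exit hB hK hBK hsource hC hp
    · obtain ⟨z', hz'K, hz'B, hz'C, hz'⟩ := ih hzB
      exact ⟨z', hz'K, hz'B, by simpa using C.add_mem hz'C hzC, hz'⟩
    · exact ⟨z, hzK, hzB, hzC, hz.trans (Or.inr h')⟩

/-- A straight line in the chart at `x` that starts at `x` and has timelike velocity is a timelike
segment. -/
theorem timelikeSegment_of_line {w : EuclideanSpace ℝ (Fin n)}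
    (htarget : ∀ t ∈ Icc (0 : ℝ) 1, extChartAt (𝓡 n) x x + t • w ∈ (extChartAt (𝓡 n) x).target)
    (hw : ∀ t ∈ Icc (0 : ℝ) 1, FutureTimelike g
      ((extChartAt (𝓡 n) x).symm (extChartAt (𝓡 n) x x + t • w))
      (chartVector x ((extChartAt (𝓡 n) x).symm (extChartAt (𝓡 n) x x + t • w)) w)) :
    TimelikeSegment g x ((extChartAt (𝓡 n) x).symm (extChartAt (𝓡 n) x x + w)) := by
  let l : ℝ → EuclideanSpace ℝ (Fin n) := fun t ↦ extChartAt (𝓡 n) x x + t • w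
  have hl : ContDiff ℝ 1 l := by fun_prop
  have hld : ∀ t, HasDerivAt l w t := fun t ↦ by
    simpa only [one_smul, id_eq] using
      ((hasDerivAt_id t).smul_const w).const_add (extChartAt (𝓡 n) x x)
  refine ⟨fun t ↦ (extChartAt (𝓡 n) x).symm (l t), 0, 1, one_pos, by simp [l], by simp [l],
    (contMDiffOn_extChartAt_symm x).comp hl.contMDiff.contMDiffOn htarget, fun t ht ↦ ?_⟩
  have hmem : (extChartAt (𝓡 n) x).symm (l t) ∈ (chartAt (EuclideanSpace ℝ (Fin n)) x).source := by
    simpa only [extChartAt_source] using (extChartAt (𝓡 n) x).map_target (htarget t ht)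
  have h1 : HasMFDerivWithinAt 𝓘(ℝ, ℝ) 𝓘(ℝ, EuclideanSpace ℝ (Fin n)) l (Icc 0 1) t
      (ContinuousLinearMap.toSpanSingleton ℝ w) :=
    (hld t).hasFDerivAt.hasFDerivWithinAt.hasMFDerivWithinAt
  have h2 := (mdifferentiableWithinAt_extChartAt_symm (I := 𝓡 n) (htarget t ht)).hasMFDerivWithinAt
  have h3 := (HasMFDerivWithinAt.comp t h2 h1 fun s _ ↦ by simp).mfderivWithin
    ((uniqueDiffOn_Icc one_pos).uniqueMDiffOn t ht)
  have h4 : mfderivWithin 𝓘(ℝ, ℝ) (𝓡 n) (fun t ↦ (extChartAt (𝓡 n) x).symm (l t)) (Icc 0 1) t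
      (1 : ℝ) = chartVector x ((extChartAt (𝓡 n) x).symm (l t)) w := by
    refine (congrArg (fun L ↦ L (1 : ℝ)) h3).trans ?_
    rw [chartVector, TangentBundle.symmL_trivializationAt hmem,
      (extChartAt (𝓡 n) x).right_inv (htarget t ht)]
    exact congrArg _ (one_smul ℝ w)
  rw [h4]
  exact hw t ht

/-- Small multiples of the time orientation, read in a chart, give points of the chronological
future arbitrarily close to `x`. -/
theorem mem_closure_setOf_I (g : SpacetimeMetric n r M) (x : M) : x ∈ closure {z | I g x z} := by
  let w : EuclideanSpace ℝ (Fin n) :=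
    mfderiv (𝓡 n) 𝓘(ℝ, EuclideanSpace ℝ (Fin n)) (extChartAt (𝓡 n) x) x (g.orient x)
  have hw : FutureTimelike g x (chartVector x x w) := by
    rw [chartVector_mfderiv (mem_chart_source _ x)]
    exact futureTimelike_orient g x
  have h1 : ∀ᶠ y in 𝓝 x, FutureTimelike g y (chartVector x y w) :=
    (Continuous.prodMk_left w).continuousAt.eventually (eventually_futureTimelike_chartVector hw)
  have hsymm := continuousAt_extChartAt_symm (I := 𝓡 n) x
  have h2 : ∀ᶠ u in 𝓝 (extChartAt (𝓡 n) x x), u ∈ (extChartAt (𝓡 n) x).target ∧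
      FutureTimelike g ((extChartAt (𝓡 n) x).symm u)
        (chartVector x ((extChartAt (𝓡 n) x).symm u) w) := by
    rw [← extChartAt_to_inv (I := 𝓡 n) x] at h1
    have h1' := hsymm.eventually h1
    rw [extChartAt_to_inv] at h1'
    exact Filter.Eventually.and (extChartAt_target_mem_nhds x) h1'
  have hline : Filter.Tendsto (fun s : ℝ ↦ extChartAt (𝓡 n) x x + s • w) (𝓝 0)
      (𝓝 (extChartAt (𝓡 n) x x)) := by
    have : Continuous fun s : ℝ ↦ extChartAt (𝓡 n) x x + s • w := by fun_prop
    simpa using this.tendsto 0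
  obtain ⟨ε, hε, hball⟩ := Metric.eventually_nhds_iff.1 (hline.eventually h2)
  have hI : ∀ s ∈ Ioo 0 ε, I g x ((extChartAt (𝓡 n) x).symm (extChartAt (𝓡 n) x x + s • w)) := by
    intro s hs
    have h3 : ∀ t ∈ Icc (0 : ℝ) 1, dist (t * s) 0 < ε := by
      intro t ht
      rw [Real.dist_0_eq_abs, abs_of_nonneg (mul_nonneg ht.1 hs.1.le)]
      exact (mul_le_of_le_one_left hs.1.le ht.2).trans_lt hs.2
    refine Relation.TransGen.single (timelikeSegment_of_line ?_ ?_)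
    · intro t ht
      rw [smul_smul]
      exact (hball (h3 t ht)).1
    · intro t ht
      rw [smul_smul, map_smul]
      exact (hball (h3 t ht)).2.smul hs.1
  have hlim : Filter.Tendsto (fun s : ℝ ↦ (extChartAt (𝓡 n) x).symm
      (extChartAt (𝓡 n) x x + s • w)) (𝓝[>] 0) (𝓝 x) := by
    have h4 := hsymm.tendsto.comp hline
    rw [extChartAt_to_inv] at h4
    exact h4.mono_left nhdsWithin_le_nhds
  exact mem_closure_of_tendsto hlim (Filter.mem_of_superset (Ioo_mem_nhdsGT hε) hI)

/-- Widening the cones absorbs a small displacement of the starting point: if `g < g'` and `p` is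
close enough to `x`, then every point outside `U` that can be reached from `p` by a `g`-causal curve
can be reached from `x` by a `g'`-timelike curve. Up to the exit point `z` from a small coordinate
ball, the causal curve is replaced by the straight line from `x` to `z`. -/
theorem Narrower.exists_nhds_I_of_causalCurveJoins [T2Space M] (h : Narrower g g') {U : Set M}
    (hU : U ∈ 𝓝 x) :
    ∃ V ∈ 𝓝 x, ∀ p ∈ V, ∀ q ∉ U, CausalCurveJoins g p q → I g' x q := by
  obtain ⟨k, hgk, hkg'⟩ := h.exists_between
  obtain ⟨δ, hδ, hnear⟩ := hkg'.exists_forall_near_futureCone x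
  set φ := extChartAt (𝓡 n) x with hφ
  have hN := (hgk.eventually_mem_futureCone x).and (hnear.and hU)
  rw [← extChartAt_to_inv (I := 𝓡 n) x] at hN
  have hN' := Filter.Eventually.and (extChartAt_target_mem_nhds (I := 𝓡 n) x)
    ((continuousAt_extChartAt_symm (I := 𝓡 n) x).eventually hN)
  rw [extChartAt_to_inv] at hN'
  obtain ⟨ρ, hρ, hball⟩ := Metric.nhds_basis_closedBall.mem_iff.1 hN'
  set K : Set M := φ.symm '' Metric.closedBall (φ x) ρ with hKdef
  set B : Set M := (chartAt (EuclideanSpace ℝ (Fin n)) x).source ∩ φ ⁻¹' Metric.ball (φ x) ρ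
    with hBdef
  have hK : IsClosed K := ((isCompact_closedBall _ _).image_of_continuousOn
    ((continuousOn_extChartAt_symm x).mono fun u hu ↦ (hball hu).1)).isClosed
  have hB : IsOpen B := isOpen_extChartAt_preimage x Metric.isOpen_ball
  have hBK : B ⊆ K := fun y hy ↦ ⟨φ y, Metric.ball_subset_closedBall hy.2,
    φ.left_inv (by simpa [hφ] using hy.1)⟩
  have hsource : K ⊆ (chartAt (EuclideanSpace ℝ (Fin n)) x).source := by
    rintro _ ⟨u, hu, rfl⟩
    simpa [hφ] using φ.map_target (hball hu).1
  have hKC : ∀ y ∈ K, ∀ v, FutureCausal g y (chartVector x y v) → v ∈ futureCone k x := by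
    rintro _ ⟨u, hu, rfl⟩
    exact (hball hu).2.1
  have hBU : B ⊆ U := by
    intro y hy
    obtain ⟨u, hu, rfl⟩ := hBK hy
    exact (hball hu).2.2.2
  have hη : 0 < min (ρ / 2) (δ * (ρ / 2)) := lt_min (half_pos hρ) (mul_pos hδ (half_pos hρ))
  refine ⟨φ ⁻¹' Metric.ball (φ x) (min (ρ / 2) (δ * (ρ / 2))) ∩
    (chartAt (EuclideanSpace ℝ (Fin n)) x).source, Filter.inter_mem
    ((continuousAt_extChartAt (I := 𝓡 n) x).preimage_mem_nhds (Metric.ball_mem_nhds _ hη))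
    (chart_source_mem_nhds _ x), ?_⟩
  rintro p ⟨hp, hps⟩ q hq hpq
  have hp : ‖φ p - φ x‖ < min (ρ / 2) (δ * (ρ / 2)) := by simpa [dist_eq_norm] using hp
  have hp1 := hp.trans_le (min_le_left _ _)
  have hp2 := hp.trans_le (min_le_right _ _)
  have hpB : p ∈ B := ⟨hps, by
    rw [mem_preimage, Metric.mem_ball, dist_eq_norm]
    linarith⟩
  obtain ⟨z, hzK, hzB, hzC, hzq⟩ :=
    hpq.exists_exit hB hK hBK hsource hKC hpB fun hqB ↦ hq (hBU hqB)
  have hzρ : ρ ≤ ‖φ z - φ x‖ := by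
    by_contra! hlt
    exact hzB ⟨hsource hzK, by rwa [mem_preimage, Metric.mem_ball, dist_eq_norm]⟩
  have hzball : φ z ∈ Metric.closedBall (φ x) ρ := by
    obtain ⟨u, hu, rfl⟩ := hzK
    rwa [φ.right_inv (hball hu).1]
  have hsub : φ z - φ x - (φ z - φ p) = φ p - φ x := by abel
  have hzp : ρ / 2 < ‖φ z - φ p‖ := by
    have h1 := norm_add_le (φ z - φ p) (φ p - φ x)
    rw [sub_add_sub_cancel] at h1
    linarith
  have hzp0 : φ z - φ p ≠ 0 := norm_pos_iff.1 ((half_pos hρ).trans hzp)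
  have hclose : ‖φ z - φ x - (φ z - φ p)‖ < δ * ‖φ z - φ p‖ := by
    rw [hsub]
    exact hp2.trans (mul_lt_mul_of_pos_left hzp hδ)
  have hmem : ∀ t ∈ Icc (0 : ℝ) 1, φ x + t • (φ z - φ x) ∈ Metric.closedBall (φ x) ρ := by
    intro t ht
    exact (convex_closedBall (φ x) ρ).add_smul_sub_mem (Metric.mem_closedBall_self hρ.le) hzball ht
  have hseg : TimelikeSegment g' x z := by
    have h1 := timelikeSegment_of_line (g := g') (x := x) (w := φ z - φ x)
      (fun t ht ↦ (hball (hmem t ht)).1)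
      (fun t ht ↦ (hball (hmem t ht)).2.2.1 _ hzC hzp0 _ hclose)
    have h2 : φ.symm (φ x + (φ z - φ x)) = z := by
      rw [add_sub_cancel]
      exact φ.left_inv (by simpa [hφ] using hsource hzK)
    rwa [← hφ, h2] at h1
  rcases hzq with rfl | hzq
  · exact Relation.TransGen.single hseg
  · exact Relation.TransGen.head hseg (I_of_causalCurveJoins_of_narrower h hzq)

/-- The time reverse of `Narrower.exists_nhds_I_of_causalCurveJoins`. -/
theorem Narrower.exists_nhds_I_of_causalCurveJoins' [T2Space M] (h : Narrower g g') {U : Set M}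
    (hU : U ∈ 𝓝 x) :
    ∃ V ∈ 𝓝 x, ∀ p ∈ V, ∀ q ∉ U, CausalCurveJoins g q p → I g' q x := by
  obtain ⟨V, hV, hVU⟩ := h.reverse.exists_nhds_I_of_causalCurveJoins hU
  exact ⟨V, hV, fun p hp q hq hqp ↦ I_reverse (hVU p hp q hq hqp.reverse)⟩

end Tilt

/-! ### The stable properties -/

section Stability

variable {n : ℕ} {r : ℕ∞} {M : Type*} [TopologicalSpace M]
  [ChartedSpace (EuclideanSpace ℝ (Fin n)) M] [IsManifold (𝓡 n) 1 M]
  {g g' : SpacetimeMetric n r M} {x y z : M}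

theorem IsCausal.isChronological (h : IsCausal g) : IsChronological g :=
  fun x hx ↦ h x (causalCurveJoins_of_I hx)

theorem IsChronological.isCausal_of_narrower (h : IsChronological g') (hg : Narrower g g') :
    IsCausal g :=
  fun x hx ↦ h x (I_of_causalCurveJoins_of_narrower hg hx)

theorem isStablyCausal_iff_stably_isChronological :
    IsStablyCausal g ↔ Stably IsChronological g := by
  refine ⟨fun ⟨g', hg, h⟩ ↦ ⟨g', hg, h.isChronological⟩, fun ⟨g', hg, h⟩ ↦ ?_⟩
  obtain ⟨k, hgk, hkg'⟩ := hg.exists_between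
  exact ⟨k, hgk, h.isCausal_of_narrower hkg'⟩

/-- A property which implies chronology, and holds for every metric that is narrower than some
causal metric, is stably equivalent to causality. -/
theorem isStablyCausal_iff_stably {P : SpacetimeMetric n r M → Prop}
    (h1 : ∀ k : SpacetimeMetric n r M, P k → IsChronological k)
    (h2 : ∀ k k' : SpacetimeMetric n r M, Narrower k k' → IsCausal k' → P k) :
    IsStablyCausal g ↔ Stably P g := by
  refine ⟨fun ⟨g', hg, h⟩ ↦ ?_, fun ⟨g', hg, h⟩ ↦
    isStablyCausal_iff_stably_isChronological.2 ⟨g', hg, h1 g' h⟩⟩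
  obtain ⟨k, hgk, hkg'⟩ := hg.exists_between
  exact ⟨k, hgk, h2 k g' hkg' h⟩

theorem I_setOf_subset (h : I g x y) : {z | I g y z} ⊆ {z | I g x z} :=
  fun _ hz ↦ Relation.TransGen.trans h hz

theorem IsDistinguishing.isChronological (h : IsDistinguishing g) : IsChronological g := by
  intro x hx
  obtain ⟨y, hne, hxy, hyx⟩ := exists_ne_of_I_self hx
  exact hne (h.1 y x ((I_setOf_subset hxy).antisymm (I_setOf_subset hyx)))

theorem IsStronglyCausal.isChronological [T1Space M] (h : IsStronglyCausal g) :
    IsChronological g := by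
  intro x hx
  obtain ⟨y, hne, hxy, hyx⟩ := exists_ne_of_I_self hx
  obtain ⟨V, hV, -, hVU⟩ := h x {y}ᶜ (isOpen_compl_singleton.mem_nhds hne.symm)
  exact hVU x (mem_of_mem_nhds hV) x (mem_of_mem_nhds hV) y (J_of_I hxy) (J_of_I hyx) rfl

theorem K_of_I (h : I g x y) : K g x y := fun _ _ _ hR ↦ hR _ _ h

theorem IsKCausal.isChronological (h : IsKCausal g) : IsChronological g := by
  intro x hx
  obtain ⟨y, hne, hxy, hyx⟩ := exists_ne_of_I_self hx
  exact hne (h.antisymm _ _ (K_of_I hyx) (K_of_I hxy))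

theorem K_refl (g : SpacetimeMetric n r M) (x : M) : K g x x := by
  intro R hclosed _ hI
  have hR : IsClosed {z | R x z} := hclosed.preimage (Continuous.prodMk_right x)
  exact closure_minimal (fun z hz ↦ hI x z hz) hR (mem_closure_setOf_I g x)

variable [T2Space M]

theorem IsCausal.isStronglyCausal_of_narrower (h : IsCausal g') (hg : Narrower g g') :
    IsStronglyCausal g := by
  intro x U hU
  obtain ⟨V₁, hV₁, hfuture⟩ := hg.exists_nhds_I_of_causalCurveJoins hU
  obtain ⟨V₂, hV₂, hpast⟩ := hg.exists_nhds_I_of_causalCurveJoins' hU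
  refine ⟨V₁ ∩ V₂ ∩ U, Filter.inter_mem (Filter.inter_mem hV₁ hV₂) hU, inter_subset_right, ?_⟩
  rintro y ⟨⟨hy, -⟩, hyU⟩ w ⟨⟨-, hw⟩, hwU⟩ z hyz hzw
  by_contra hz
  rcases hyz with rfl | hyz
  · exact hz hyU
  rcases hzw with rfl | hzw
  · exact hz hwU
  · exact h.isChronological x
      (Relation.TransGen.trans (hfuture y hy z hz hyz) (hpast w hw z hz hzw))

/-- If `y` is in the closure of the chronological future of `x ≠ y`, then `y` is in the
chronological future of `x` for any wider metric. -/
theorem Narrower.I_of_mem_closure (hg : Narrower g g') (hne : x ≠ y)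
    (h : y ∈ closure {z | I g x z}) : I g' x y := by
  obtain ⟨V, hV, hVI⟩ := hg.exists_nhds_I_of_causalCurveJoins'
    (isOpen_compl_singleton.mem_nhds hne.symm : {x}ᶜ ∈ 𝓝 y)
  obtain ⟨z, hzV, hz⟩ := mem_closure_iff_nhds.1 h V hV
  exact hVI z hzV x (by simp) (causalCurveJoins_of_I hz)

theorem Narrower.eq_of_I_setOf_eq (hg : Narrower g g') (h : IsCausal g')
    (hxy : {z | I g x z} = {z | I g y z}) : x = y := by
  by_contra hne
  have h1 : I g' x y := hg.I_of_mem_closure hne (hxy ▸ mem_closure_setOf_I g y)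
  have h2 : I g' y x := hg.I_of_mem_closure (Ne.symm hne) (hxy ▸ mem_closure_setOf_I g x)
  exact h.isChronological x (Relation.TransGen.trans h1 h2)

theorem IsCausal.isDistinguishing_of_narrower (h : IsCausal g') (hg : Narrower g g') :
    IsDistinguishing g := by
  refine ⟨fun x y hxy ↦ hg.eq_of_I_setOf_eq h hxy, fun x y hxy ↦ ?_⟩
  refine hg.reverse.eq_of_I_setOf_eq h.reverse ?_
  simpa only [I_reverse_iff] using hxy

variable (g) in
/-- The Seifert relation: `z` is in the causal future of `x` for every metric wider than `g`. -/
def Seifert (x z : M) : Prop :=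
  ∀ k : SpacetimeMetric n r M, Narrower g k → J k x z

/-- The Seifert relation is closed: given `k > g`, both endpoints of a causal curve of a metric
close to `g` are moved to their limits, one at a time, at the cost of two widenings below `k`. -/
theorem isClosed_seifert (g : SpacetimeMetric n r M) :
    IsClosed {p : M × M | Seifert g p.1 p.2} := by
  refine isClosed_of_closure_subset ?_
  rintro ⟨x, y⟩ hxy k hk
  rcases eq_or_ne x y with hne | hne
  · exact Or.inl hne
  obtain ⟨k₂, hgk₂, hk₂⟩ := hk.exists_between
  obtain ⟨k₁, hgk₁, hk₁⟩ := hgk₂.exists_between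
  obtain ⟨U, W, hU, hW, hxU, hyW, hUW⟩ := t2_separation hne
  obtain ⟨V₁, hV₁, hfuture⟩ := hk₁.exists_nhds_I_of_causalCurveJoins (hU.mem_nhds hxU)
  obtain ⟨V₂, hV₂, hpast⟩ := hk₂.exists_nhds_I_of_causalCurveJoins'
    (isOpen_compl_singleton.mem_nhds hne.symm : {x}ᶜ ∈ 𝓝 y)
  obtain ⟨⟨p, q⟩, ⟨⟨hpV, hpU⟩, hqV, hqW⟩, hpq⟩ := mem_closure_iff_nhds.1 hxy _
    (prod_mem_nhds (Filter.inter_mem hV₁ (hU.mem_nhds hxU))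
      (Filter.inter_mem hV₂ (hW.mem_nhds hyW)))
  have hqU : q ∉ U := fun hqU ↦ hUW.notMem_of_mem_left hqU hqW
  rcases hpq k₁ hgk₁ with heq | hpq
  · exact absurd ((show p = q from heq) ▸ hpU) hqU
  · exact J_of_I (hpast q hqV x (by simp) (causalCurveJoins_of_I (hfuture p hpV q hqU hpq)))

theorem K.seifert (h : K g x z) : Seifert g x z := by
  refine h _ (isClosed_seifert g) (fun a b c hab hbc k hk ↦ (hab k hk).trans (hbc k hk)) ?_
  exact fun a b hab k hk ↦ J_of_I (I_of_causalCurveJoins_of_narrower hk (causalCurveJoins_of_I hab))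

theorem IsCausal.isKCausal_of_narrower (h : IsCausal g') (hg : Narrower g g') : IsKCausal g where
  refl := K_refl g
  trans a b c hab hbc R hR htrans hI := htrans a b c (hab R hR htrans hI) (hbc R hR htrans hI)
  antisymm a b hab hba := by
    rcases hab.seifert g' hg with heq | hab'
    · exact heq
    rcases hba.seifert g' hg with heq | hba'
    · exact heq.symm
    · exact absurd (Relation.TransGen.trans hab' hba') (h a)

end Stability

end Spacetimes

theorem mainTheorem10 (n : ℕ) (hn : 2 ≤ n) (r : ℕ∞) (hr : 2 ≤ r)
    (M : Type*) [TopologicalSpace M] [T2Space M] [SecondCountableTopology M] [ConnectedSpace M]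
    [ChartedSpace (EuclideanSpace ℝ (Fin n)) M]
    [IsManifold (𝓡 n) 1 M] [IsManifold (𝓡 n) ((r : ℕ∞ω) + 1) M]
    (g : Spacetimes.SpacetimeMetric n r M) :
    (Spacetimes.IsStablyCausal g ↔ Spacetimes.Stably Spacetimes.IsChronological g) ∧
    (Spacetimes.IsStablyCausal g ↔ Spacetimes.Stably Spacetimes.IsDistinguishing g) ∧
    (Spacetimes.IsStablyCausal g ↔ Spacetimes.Stably Spacetimes.IsStronglyCausal g) ∧
    (Spacetimes.IsStablyCausal g ↔ Spacetimes.Stably Spacetimes.IsKCausal g) ∧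
    (Spacetimes.IsStablyCausal g ↔ Spacetimes.Stably Spacetimes.IsStablyCausal g) := by
  refine ⟨Spacetimes.isStablyCausal_iff_stably_isChronological,
    Spacetimes.isStablyCausal_iff_stably (fun _ h ↦ h.isChronological)
      fun _ _ hk h ↦ h.isDistinguishing_of_narrower hk,
    Spacetimes.isStablyCausal_iff_stably (fun _ h ↦ h.isChronological)
      fun _ _ hk h ↦ h.isStronglyCausal_of_narrower hk,
    Spacetimes.isStablyCausal_iff_stably (fun _ h ↦ h.isChronological)
      fun _ _ hk h ↦ h.isKCausal_of_narrower hk, ?_, ?_⟩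
  · rintro ⟨g', hg, h⟩
    obtain ⟨k, hgk, hkg'⟩ := hg.exists_between
    exact ⟨k, hgk, g', hkg', h⟩
  · rintro ⟨g', hg, g'', hg', h⟩
    exact ⟨g'', hg.trans hg', h⟩
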